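/- Let $A\in \mathrm{GL}(n,\mathbb R)$ with $|\det A|>1$, let $\Gamma\subset\mathbb R^n$ be a full-rank lattice, put $B=A^T$ and let $\Gamma^*=\{x\in\mathbb R^n:\langle x,y\rangle\in\mathbb Z\text{ for all }y\in\Gamma\}$ be the dual lattice. Let $E=E^c\cap\mathbb R^n$, where $E^c\subset\mathbb C^n$ is the span of the generalized eigenspaces of $B$, acting on $\mathbb C^n$, corresponding to the eigenvalues $\lambda$ with $|\lambda|\le 1$. Let $\hat f$ denote the Fourier transform on $L^2(\mathbb R^n)$, the extension of $\hat f(\xi)=\int_{\mathbb R^n} f(x)e^{-2\pi i\langle \xi,x\rangle}\,dx$, and let $\mathcal D_E$ be the set of all $f\in L^2(\mathbb R^n)$ such that $\hat f\in L^\infty(\mathbb R^n)$ and $\hat f$ vanishes almost everywhere outside some compact subset of $\mathbb R^n\setminus E$. The following assertions are equivalent: (i) $(B,\Gamma^*)$ satisfies the lattice counting estimate: for every $r>0$ there is a constant $C$ such that $$\#\bigl(\Gamma^*\cap B^j(\mathbf B(0,r))\bigr)\le C\max(1,|\det B|^j)\qquad\text{for all } j\in\mathbb Z,$$ where $\mathbf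 B(0,r)$ is the open ball of radius $r$ centered at $0$. (ii) For every finite family $\Psi=\{\psi_1,\dots,\psi_L\}\subset L^2(\mathbb R^n)$, the wavelet system $\mathcal A(\Psi,A,\Gamma)=\{|\det A|^{j/2}\psi_\ell(A^j\cdot-\gamma): j\in\mathbb Z,\ \gamma\in\Gamma,\ 1\le\ell\le L\}$ satisfies the local integrability condition $$\sum_{\ell=1}^L\sum_{j\in\mathbb Z}\sum_{k\in\Gamma^*}\int_{\operatorname{supp}\hat f}|\hat f(\xi+B^jk)|^2\,|\hat\psi_\ell(B^{-j}\xi)|^2\,d\xi<\infty\qquad\text{for all } f\in\mathcal D_E,$$ where $\operatorname{supp}\hat f=\{\xi:\hat f(\xi)\ne0\}$, if and only if $\Psi$ satisfies the Calderón integrability condition $$\sum_{\ell=1}^L\sum_{j\in\mathbb Z}|\hat\psi_\ell(B^{-j}\xi)|^2\in L^1_{\mathrm{loc}}(\mathbb R^n\setminus E),$$ i.e. the integral of this sum over every compact subset of $\mathbb R^n\setminus E$ is finite. -/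

import Mathlib

open MeasureTheory Set
open scoped ENNReal FourierTransform

noncomputable section

namespace WaveletLIC

/-- Euclidean space `ℝⁿ`. -/
abbrev Rn (n : ℕ) : Type := EuclideanSpace ℝ (Fin n)

/-- The space `L²(ℝⁿ)` of complex-valued functions. -/
abbrev L2 (n : ℕ) : Type := Lp ℂ 2 (volume : Measure (Rn n))

/-- The action `x ↦ B^j x` of an integer power of a square matrix on `ℝⁿ`. -/
def powAct {n : ℕ} (B : Matrix (Fin n) (Fin n) ℝ) (j : ℤ) (x : Rn n) : Rn n :=
  Matrix.toEuclideanLin (B ^ j) x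

/-- The dual lattice `Γ* = {x : ⟪x, y⟫ ∈ ℤ for all y ∈ Γ}`. -/
def dualLattice {n : ℕ} (Γ : Submodule ℤ (Rn n)) : Submodule ℤ (Rn n) :=
  LinearMap.BilinForm.dualSubmodule (innerₗ (Rn n)) Γ

theorem mem_dualLattice {n : ℕ} {Γ : Submodule ℤ (Rn n)} {x : Rn n} :
    x ∈ dualLattice Γ ↔ ∀ y ∈ Γ, ∃ m : ℤ, inner ℝ x y = (m : ℝ) := by
  unfold dualLattice
  rw [LinearMap.BilinForm.mem_dualSubmodule]
  refine forall₂_congr fun y _ => ?_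
  rw [Submodule.mem_one]
  exact ⟨fun ⟨m, hm⟩ => ⟨m, by simpa using hm.symm⟩, fun ⟨m, hm⟩ => ⟨m, by simpa using hm.symm⟩⟩

/-- The lattice counting estimate for `(B, Λ)`: for every radius `r > 0` there is a constant `C`
(depending on `r`) with `#(Λ ∩ B^j(𝐁(0, r))) ≤ C max(1, |det B|^j)` for all `j ∈ ℤ`. -/
def LatticeCountingEstimate {n : ℕ} (B : Matrix (Fin n) (Fin n) ℝ)
    (Λ : Submodule ℤ (Rn n)) : Prop :=
  ∀ r : ℝ, 0 < r → ∃ C : ℝ, ∀ j : ℤ,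
    ((Λ : Set (Rn n)) ∩ powAct B j '' Metric.ball 0 r).Finite ∧
    (((Λ : Set (Rn n)) ∩ powAct B j '' Metric.ball 0 r).ncard : ℝ) ≤ C * max 1 (|B.det| ^ j)

/-- The space `E^c ⊆ ℂⁿ`: the span of the generalized eigenspaces of `B` (acting on `ℂⁿ`) for the
eigenvalues `μ` with `|μ| ≤ 1`. -/
def complexNonexpandingSubspace {n : ℕ} (B : Matrix (Fin n) (Fin n) ℝ) :
    Submodule ℂ (Fin n → ℂ) :=
  ⨆ (μ : ℂ) (_ : ‖μ‖ ≤ 1),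
    Module.End.maxGenEigenspace (Matrix.toLin' (B.map ((↑) : ℝ → ℂ))) μ

/-- The inclusion `ℝⁿ → ℂⁿ`. -/
def complexify (n : ℕ) : Rn n →ₗ[ℝ] (Fin n → ℂ) where
  toFun x i := (x i : ℂ)
  map_add' x y := by ext i; simp
  map_smul' c x := by ext i; simp

/-- The space `E = E^c ∩ ℝⁿ`. -/
def nonexpandingSubspace {n : ℕ} (B : Matrix (Fin n) (Fin n) ℝ) : Submodule ℝ (Rn n) :=
  ((complexNonexpandingSubspace B).restrictScalars ℝ).comap (complexify n)

/-- The class `𝓓_E`: functions `f ∈ L²(ℝⁿ)` whose Fourier transform is essentially bounded and has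
compact support contained in `ℝⁿ ∖ E`, i.e. vanishes a.e. outside a compact subset of `ℝⁿ ∖ E`. -/
def testClass {n : ℕ} (E : Submodule ℝ (Rn n)) : Set (L2 n) :=
  {f | MemLp (𝓕 f : L2 n) ∞ volume ∧
    ∃ K : Set (Rn n), IsCompact K ∧ K ⊆ (E : Set (Rn n))ᶜ ∧
      ∀ᵐ ξ : Rn n, ξ ∉ K → (𝓕 f : L2 n) ξ = 0}

/-- The quantity
`L(f) = ∑_ℓ ∑_{j ∈ ℤ} ∑_{k ∈ Γ*} ∫_{supp f̂} |f̂(ξ + B^j k)|² |ψ̂_ℓ(B^{-j} ξ)|² dξ ∈ [0, ∞]`, `B = Aᵀ`,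
of the wavelet system generated by `ψ_1, …, ψ_L` with dilation `A` and lattice `Γ`. -/
def licSum {n L : ℕ} (ψ : Fin L → L2 n) (A : Matrix (Fin n) (Fin n) ℝ)
    (Γ : Submodule ℤ (Rn n)) (f : L2 n) : ℝ≥0∞ :=
  ∑ l : Fin L, ∑' j : ℤ, ∑' k : dualLattice Γ,
    ∫⁻ ξ in Function.support (𝓕 f : L2 n),
      ‖(𝓕 f : L2 n) (ξ + powAct A.transpose j k)‖ₑ ^ 2 *
        ‖(𝓕 (ψ l) : L2 n) (powAct A.transpose (-j) ξ)‖ₑ ^ 2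

/-- The local integrability condition for the wavelet system of `(ψ, A, Γ)`, relative to the
subspace `E`: `L(f) < ∞` for all `f ∈ 𝓓_E`. -/
def LocalIntegrabilityCondition {n L : ℕ} (E : Submodule ℝ (Rn n)) (ψ : Fin L → L2 n)
    (A : Matrix (Fin n) (Fin n) ℝ) (Γ : Submodule ℤ (Rn n)) : Prop :=
  ∀ f ∈ testClass E, licSum ψ A Γ f < ∞

/-- The Calderón sum `∑_ℓ ∑_{j ∈ ℤ} |ψ̂_ℓ(B^{-j} ξ)|² ∈ [0, ∞]`. -/
def calderonSum {n L : ℕ} (ψ : Fin L → L2 n) (B : Matrix (Fin n) (Fin n) ℝ) (ξ : Rn n) : ℝ≥0∞ :=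
  ∑ l : Fin L, ∑' j : ℤ, ‖(𝓕 (ψ l) : L2 n) (powAct B (-j) ξ)‖ₑ ^ 2

/-- The Calderón integrability condition: the Calderón sum is in `L¹_loc(ℝⁿ ∖ E)`, i.e. its
integral over every compact subset of `ℝⁿ ∖ E` is finite. -/
def CalderonIntegrability {n L : ℕ} (E : Submodule ℝ (Rn n)) (ψ : Fin L → L2 n)
    (B : Matrix (Fin n) (Fin n) ℝ) : Prop :=
  ∀ K : Set (Rn n), IsCompact K → K ⊆ (E : Set (Rn n))ᶜ →
    ∫⁻ ξ in K, calderonSum ψ B ξ < ∞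

end WaveletLIC

end

/-!
Write `B = Aᵀ`, `Λ = Γ*` and `E` for the nonexpanding subspace. The argument rests on one dynamical
fact, `exists_tsum_indicator_powAct_le`: an orbit of `B` visits a compact set off `E` at most
`N` times, with `N` independent of the orbit. It holds because a bounded point `B ^ m x` pulls back
under `B ^ (-m)` to a point near `E`, the inverse contracting the generalized eigenspaces for
eigenvalues outside the unit disc (`exists_forall_norm_pow_gt`).

* The local integrability condition implies the Calderón condition for every `Ψ`: take `f̂ = 1_K`
  and keep the terms `k = 0`.
* If the counting estimate holds and `f̂` is supported in `K`, at scale `j` only the `k ∈ Λ` with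
  `B ^ j k` in a fixed ball contribute, and there are at most `C (1 + |det B| ^ (-j))` of them. The
  first part is bounded by the Calderón integral over `K`; the second is, after the substitution
  `ξ = B ^ j η`, the integral of `|ψ̂|²` against the number of visits of the orbit of `η` to `K`,
  hence at most `N ‖ψ‖²` (`LatticeCountingEstimate.localIntegrabilityCondition`).
* If the counting estimate fails at radius `r`, there are scales `j_i` with more than
  `4 ^ i max (1, |det B| ^ j_i)` points of `Λ` in `B ^ j_i` of the `r`-ball. As `|det B| > 1`, `E` is
  a proper subspace, so there is a ball `D` of radius `r` whose concentric double avoids `E`.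
  The function with `|ψ̂|² = ∑ 2 ^ (-i) max (1, |det B| ^ j_i)⁻¹ 1_{B ^ j_i D}` is in `L²`, has a
  bounded Calderón sum, and its local integrability sum is at least `2 ^ i |D|` for every `i`
  (`exists_calderonIntegrability_not_localIntegrabilityCondition`).
-/

namespace WaveletLIC

open Filter Topology

variable {n : ℕ}

/-! ### Growth off the nonexpanding subspace -/

theorem tendsto_zero_of_le_mul_add {a e : ℕ → ℝ} {ρ : ℝ} (ha : ∀ m, 0 ≤ a m) (hρ0 : 0 ≤ ρ)
    (hρ : ρ < 1) (h : ∀ m, a (m + 1) ≤ ρ * a m + e m) (he : Tendsto e atTop (𝓝 0)) :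
    Tendsto a atTop (𝓝 0) := by
  rw [Metric.tendsto_atTop]
  intro ε hε
  have hδ : 0 < (1 - ρ) * (ε / 2) := mul_pos (by linarith) (by linarith)
  obtain ⟨N, hN⟩ := eventually_atTop.1 (he.eventually_lt_const hδ)
  have key : ∀ k, a (N + k) ≤ ρ ^ k * a N + ε / 2 := by
    intro k
    induction k with
    | zero => simp; linarith
    | succ k ih =>
      have h1 := h (N + k)
      have h2 := hN (N + k) (by omega)
      have h3 := mul_le_mul_of_nonneg_left ih hρ0
      rw [← add_assoc, pow_succ]
      nlinarith
  have hlim : Tendsto (fun k => ρ ^ k * a N) atTop (𝓝 0) := by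
    simpa using (tendsto_pow_atTop_nhds_zero_of_lt_one hρ0 hρ).mul_const (a N)
  obtain ⟨N', hN'⟩ := eventually_atTop.1 (hlim.eventually_lt_const (half_pos hε))
  refine ⟨N + N', fun m hm => ?_⟩
  obtain ⟨k, rfl⟩ := Nat.exists_eq_add_of_le (show N ≤ m by omega)
  have h1 := key k
  have h2 := hN' k (by omega)
  rw [Real.dist_eq, sub_zero, abs_of_nonneg (ha _)]
  linarith

/-- If `T` is invertible with inverse `S`, the powers of `S` decay on the generalized eigenspaces
of `T` for eigenvalues outside the closed unit disc: by induction on the height of the generalized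
eigenvector `w`, the orbit `S ^ m w` satisfies `u (m + 1) = μ⁻¹ • u m + o(1)`. -/
theorem tendsto_pow_inverse_of_mem_maxGenEigenspace {V : Type*} [NormedAddCommGroup V]
    [NormedSpace ℂ V] {T S : Module.End ℂ V} (hST : S * T = 1) {μ : ℂ} (hμ : 1 < ‖μ‖) {w : V}
    (hw : w ∈ T.maxGenEigenspace μ) : Tendsto (fun m : ℕ => (S ^ m) w) atTop (𝓝 0) := by
  have hμ0 : μ ≠ 0 := by
    rintro rfl
    simp at hμ
    linarith
  obtain ⟨k, hk⟩ := (Module.End.mem_maxGenEigenspace T μ w).1 hw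
  clear hw
  induction k generalizing w with
  | zero =>
    have : w = 0 := by simpa using hk
    simp [this]
  | succ k ih =>
    have h1 := ih (w := (T - μ • 1) w) (by simpa [pow_succ] using hk)
    have hrec : ∀ m : ℕ, (S ^ (m + 1)) w - μ⁻¹ • (S ^ m) w
        = -(μ⁻¹ • (S ^ (m + 1)) ((T - μ • 1) w)) := by
      intro m
      have h2 : (S ^ (m + 1)) (T w) = (S ^ m) w := by
        have : S (T w) = w := by simpa using LinearMap.congr_fun hST w
        rw [pow_succ, Module.End.mul_apply, this]
      simp [h2, smul_sub, smul_smul, hμ0]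
    rw [tendsto_zero_iff_norm_tendsto_zero]
    refine tendsto_zero_of_le_mul_add (ρ := ‖μ⁻¹‖)
      (e := fun m => ‖-(μ⁻¹ • (S ^ (m + 1)) ((T - μ • 1) w))‖) (fun _ => norm_nonneg _)
      (norm_nonneg _) (by rw [norm_inv]; exact inv_lt_one_of_one_lt₀ hμ) ?_ ?_
    · intro m
      rw [← hrec, ← norm_smul]
      have := norm_add_le (μ⁻¹ • (S ^ m) w) ((S ^ (m + 1)) w - μ⁻¹ • (S ^ m) w)
      simpa using this
    · have h3 := (tendsto_add_atTop_iff_nat 1).2 h1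
      simpa using (h3.const_smul μ⁻¹).neg.norm

/-- A compact set off the sum of the generalized eigenspaces for `‖μ‖ ≤ 1` is carried out of any
ball by the large powers of `T`. Every `y = T ^ m x` splits as `a + f` along the two families of
generalized eigenspaces; if `y` is bounded then `x = T ^ (-m) a + T ^ (-m) f` is close to the
sum of the generalized eigenspaces for `‖μ‖ ≤ 1`. -/
theorem exists_forall_norm_pow_gt {ι : Type*} [Fintype ι] {T S : Module.End ℂ (ι → ℂ)}
    (hST : S * T = 1) (hTS : T * S = 1) {K : Set (ι → ℂ)} (hK : IsCompact K)
    (hd : ∀ x ∈ K, x ∉ (⨆ (μ : ℂ) (_ : ‖μ‖ ≤ 1), T.maxGenEigenspace μ)) (R : ℝ) :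
    ∃ M : ℕ, ∀ m, M ≤ m → ∀ x ∈ K, R < ‖(T ^ m) x‖ := by
  classical
  set U : Submodule ℂ (ι → ℂ) := ⨆ (μ : ℂ) (_ : ‖μ‖ ≤ 1), T.maxGenEigenspace μ with hU
  let W : Submodule ℂ (ι → ℂ) :=
    { carrier := {w | Tendsto (fun m : ℕ => (S ^ m) w) atTop (𝓝 0)}
      add_mem' := fun {a b} ha hb => by simpa using Tendsto.add ha hb
      zero_mem' := by simp
      smul_mem' := fun c a ha => by simpa using Tendsto.const_smul ha c }
  have htop : U ⊔ W = ⊤ := by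
    rw [eq_top_iff, ← Module.End.iSup_maxGenEigenspace_eq_top T]
    refine iSup_le fun μ => ?_
    rcases le_or_gt ‖μ‖ 1 with h | h
    · exact le_sup_of_le_left (le_iSup₂_of_le μ h le_rfl)
    · exact le_sup_of_le_right
        fun w hw => tendsto_pow_inverse_of_mem_maxGenEigenspace hST h hw
  have hUS : ∀ m : ℕ, ∀ x ∈ U, (S ^ m) x ∈ U := by
    intro m
    have hcomm : Commute T (S ^ m) := (show Commute T S from hTS.trans hST.symm).pow_right m
    suffices U ≤ U.comap (S ^ m) from fun x hx => this hx
    refine iSup₂_le fun μ hμ x hx => ?_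
    exact (le_iSup₂_of_le μ hμ le_rfl : T.maxGenEigenspace μ ≤ U)
      (Module.End.mapsTo_maxGenEigenspace_of_comm hcomm μ hx)
  have hsplit : ∀ i : ι, ∃ a ∈ U, ∃ f ∈ W, a + f = Pi.single i (1 : ℂ) := fun i =>
    Submodule.mem_sup.1 (htop ▸ Submodule.mem_top)
  choose a ha f hf haf using hsplit
  obtain ⟨δ, hδ, hdisj⟩ := Disjoint.exists_thickenings
    (Set.disjoint_left.2 hd : Disjoint K (U : Set (ι → ℂ))) hK
    (Submodule.closed_of_finiteDimensional U)
  have hlim : Tendsto (fun m : ℕ => |R| * ∑ i, ‖(S ^ m) (f i)‖) atTop (𝓝 0) := by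
    have : Tendsto (fun m : ℕ => ∑ i, ‖(S ^ m) (f i)‖) atTop (𝓝 (∑ _i : ι, 0)) :=
      tendsto_finsetSum _ fun i _ => tendsto_zero_iff_norm_tendsto_zero.1 (hf i)
    simpa using this.const_mul |R|
  obtain ⟨M, hM⟩ := eventually_atTop.1 (hlim.eventually_lt_const hδ)
  refine ⟨M, fun m hm x hx => ?_⟩
  by_contra! hle
  set y := (T ^ m) x with hy
  have hxy : (S ^ m) y = x := by
    rw [hy, ← Module.End.mul_apply, ← (show Commute S T from hST.trans hTS.symm).mul_pow, hST]
    simp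
  have hysum : y = ∑ i, y i • a i + ∑ i, y i • f i := by
    rw [← Finset.sum_add_distrib]
    simp_rw [← smul_add, haf]
    exact pi_eq_sum_univ' y
  have hmem : (S ^ m) (∑ i, y i • a i) ∈ U :=
    hUS m _ (Submodule.sum_mem _ fun i _ => U.smul_mem _ (ha i))
  have hdist : dist x ((S ^ m) (∑ i, y i • a i)) < δ := by
    refine lt_of_le_of_lt ?_ (hM m hm)
    rw [dist_eq_norm]
    have : x - (S ^ m) (∑ i, y i • a i) = ∑ i, y i • (S ^ m) (f i) := by
      conv_lhs => rw [← hxy, hysum]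
      rw [map_add, ← hysum]
      simp [map_sum]
    rw [this, Finset.mul_sum]
    refine (norm_sum_le _ _).trans (Finset.sum_le_sum fun i _ => ?_)
    rw [norm_smul]
    gcongr
    exact (norm_le_pi_norm y i).trans (hle.trans (le_abs_self R))
  exact Set.disjoint_left.1 hdisj (Metric.self_subset_thickening hδ K hx)
    (Metric.mem_thickening_iff.2 ⟨_, hmem, hdist⟩)

/-! ### Orbits of a matrix acting on `ℝⁿ` -/

theorem powAct_add_apply {B : Matrix (Fin n) (Fin n) ℝ} (hB : B.det ≠ 0) (i j : ℤ) (x : Rn n) :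
    powAct B (i + j) x = powAct B i (powAct B j x) := by
  simp only [powAct, Matrix.zpow_add (isUnit_iff_ne_zero.2 hB)]
  ext
  simp [Matrix.toLpLin_apply]

@[simp]
theorem powAct_zero_apply (B : Matrix (Fin n) (Fin n) ℝ) (x : Rn n) : powAct B 0 x = x := by
  ext
  simp [powAct]

theorem powAct_neg_apply_powAct {B : Matrix (Fin n) (Fin n) ℝ} (hB : B.det ≠ 0) (j : ℤ)
    (x : Rn n) : powAct B (-j) (powAct B j x) = x := by
  rw [← powAct_add_apply hB]; simp

theorem powAct_apply_powAct_neg {B : Matrix (Fin n) (Fin n) ℝ} (hB : B.det ≠ 0) (j : ℤ)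
    (x : Rn n) : powAct B j (powAct B (-j) x) = x := by
  rw [← powAct_add_apply hB]; simp

theorem complexify_powAct (B : Matrix (Fin n) (Fin n) ℝ) (m : ℕ) (x : Rn n) :
    complexify n (powAct B m x)
      = (Matrix.toLin' (B.map ((↑) : ℝ → ℂ)) ^ m) (complexify n x) := by
  have h1 : ∀ (M : Matrix (Fin n) (Fin n) ℝ) (x : Rn n),
      complexify n (Matrix.toEuclideanLin M x)
        = Matrix.toLin' (M.map ((↑) : ℝ → ℂ)) (complexify n x) := by
    intro M x
    ext i
    simp [complexify, Matrix.toLpLin_apply, Matrix.mulVec, dotProduct]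
  rw [powAct, zpow_natCast, h1, ← Matrix.toLin'_pow]
  congr 2
  exact map_pow (Complex.ofRealHom.mapMatrix) B m

theorem continuous_complexify (n : ℕ) : Continuous (complexify n) :=
  LinearMap.continuous_of_finiteDimensional _

theorem exists_forall_norm_powAct_gt {B : Matrix (Fin n) (Fin n) ℝ} (hB : B.det ≠ 0)
    {K : Set (Rn n)} (hK : IsCompact K) (hKE : K ⊆ (nonexpandingSubspace B : Set (Rn n))ᶜ)
    (R : ℝ) : ∃ M : ℕ, ∀ m : ℕ, M ≤ m → ∀ x ∈ K, R < ‖powAct B m x‖ := by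
  set BC : Matrix (Fin n) (Fin n) ℂ := B.map ((↑) : ℝ → ℂ) with hBC
  have hdet : IsUnit BC.det := by
    have : BC.det = (B.det : ℂ) := (Complex.ofRealHom.map_det B).symm
    rw [this]
    exact isUnit_iff_ne_zero.2 (by exact_mod_cast hB)
  obtain ⟨M, hM⟩ := exists_forall_norm_pow_gt (T := Matrix.toLin' BC) (S := Matrix.toLin' BC⁻¹)
    (by rw [Module.End.mul_eq_comp, ← Matrix.toLin'_mul, Matrix.nonsing_inv_mul _ hdet]; simp; rfl)
    (by rw [Module.End.mul_eq_comp, ← Matrix.toLin'_mul, Matrix.mul_nonsing_inv _ hdet]; simp; rfl)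
    (hK.image (continuous_complexify n)) (by rintro _ ⟨x, hx, rfl⟩ h; exact hKE hx h) |R|
  refine ⟨M, fun m hm x hx => ?_⟩
  have h1 := hM m hm _ (mem_image_of_mem _ hx)
  rw [← complexify_powAct] at h1
  refine (le_abs_self R).trans_lt (h1.trans_le ?_)
  -- the supremum norm of the complexification is at most the Euclidean norm
  refine (pi_norm_le_iff_of_nonneg (norm_nonneg _)).2 fun i => ?_
  simpa [complexify] using PiLp.norm_apply_le (powAct B m x) i

/-- An orbit of `B` meets a compact set off the nonexpanding subspace at most a bounded number of
times. -/
theorem exists_tsum_indicator_powAct_le {B : Matrix (Fin n) (Fin n) ℝ} (hB : B.det ≠ 0)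
    {K : Set (Rn n)} (hK : IsCompact K) (hKE : K ⊆ (nonexpandingSubspace B : Set (Rn n))ᶜ) :
    ∃ N : ℕ, ∀ ξ : Rn n, ∑' j : ℤ, K.indicator (1 : Rn n → ℝ≥0∞) (powAct B j ξ) ≤ N := by
  obtain ⟨R, hR⟩ := hK.isBounded.exists_norm_le
  obtain ⟨M, hM⟩ := exists_forall_norm_powAct_gt hB hK hKE R
  have hret : ∀ (i j : ℤ) (ξ : Rn n), powAct B i ξ ∈ K → powAct B j ξ ∈ K → j - i < M := by
    intro i j ξ hi hj
    by_contra! hle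
    obtain ⟨m, hm⟩ := Int.eq_ofNat_of_zero_le (show 0 ≤ j - i by omega)
    have h1 := hM m (by omega) _ hi
    rw [← hm, ← powAct_add_apply hB, sub_add_cancel] at h1
    exact absurd (hR _ hj) (not_le.2 h1)
  refine ⟨2 * M, fun ξ => ?_⟩
  by_cases hex : ∃ i, powAct B i ξ ∈ K
  · obtain ⟨i, hi⟩ := hex
    rw [tsum_eq_sum (s := Finset.Ioo (i - M) (i + M))]
    · refine (Finset.sum_le_card_nsmul _ _ (1 : ℝ≥0∞) fun j _ => ?_).trans ?_
      · exact indicator_apply_le' (fun _ => le_rfl) fun _ => zero_le_one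
      rw [Int.card_Ioo, nsmul_eq_mul, mul_one]
      exact_mod_cast (by omega)
    · intro j hj
      refine indicator_of_notMem (fun hjK => hj ?_) _
      have h1 := hret i j ξ hi hjK
      have h2 := hret j i ξ hjK hi
      exact Finset.mem_Ioo.2 ⟨by omega, by omega⟩
  · push Not at hex
    simp [indicator_of_notMem (hex _)]

theorem exists_notMem_nonexpandingSubspace {B : Matrix (Fin n) (Fin n) ℝ} (hB : 1 < |B.det|) :
    ∃ x : Rn n, x ∉ nonexpandingSubspace B := by
  set BC : Matrix (Fin n) (Fin n) ℂ := B.map ((↑) : ℝ → ℂ) with hBC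
  have hdet : 1 < ‖BC.det‖ := by
    have : BC.det = (B.det : ℂ) := (Complex.ofRealHom.map_det B).symm
    rwa [this, Complex.norm_real]
  -- the determinant is the product of the eigenvalues, so one of them lies outside the unit disc
  obtain ⟨μ, hμ, hμ1⟩ : ∃ μ ∈ BC.charpoly.roots, 1 < ‖μ‖ := by
    by_contra! hcon
    rw [Matrix.det_eq_prod_roots_charpoly] at hdet
    have : ∀ s : Multiset ℂ, (∀ μ ∈ s, ‖μ‖ ≤ 1) → ‖s.prod‖ ≤ 1 := by
      intro s
      induction s using Multiset.induction with
      | empty => simp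
      | cons a s ih =>
        intro h
        rw [Multiset.prod_cons, norm_mul]
        exact mul_le_one₀ (h a (by simp)) (norm_nonneg _) (ih fun μ hμ => h μ (by simp [hμ]))
    exact absurd (this _ hcon) (not_le.2 hdet)
  have hev : Module.End.HasEigenvalue (Matrix.toLin' BC) μ := by
    rw [Module.End.hasEigenvalue_iff_isRoot_charpoly, Matrix.charpoly_toLin']
    exact Polynomial.isRoot_of_mem_roots hμ
  obtain ⟨v, hv⟩ := hev.exists_hasEigenvector
  have hvE : v ∉ complexNonexpandingSubspace B := by
    intro hmem
    have hle : complexNonexpandingSubspace B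
        ≤ ⨆ (ν : ℂ) (_ : ν ≠ μ), Module.End.maxGenEigenspace (Matrix.toLin' BC) ν :=
      iSup₂_le fun ν hν => le_iSup₂_of_le ν (by rintro rfl; exact absurd hν (not_le.2 hμ1)) le_rfl
    have hdisj := Module.End.independent_maxGenEigenspace (Matrix.toLin' BC) μ
    have hvmax : v ∈ Module.End.maxGenEigenspace (Matrix.toLin' BC) μ :=
      (Module.End.mem_maxGenEigenspace _ _ _).2 ⟨1, by
        simpa [sub_eq_zero] using hv.apply_eq_smul⟩
    exact hv.2 (Submodule.disjoint_def.1 hdisj v hvmax (hle hmem))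
  by_contra! hall
  refine hvE ?_
  rw [pi_eq_sum_univ' v]
  refine Submodule.sum_mem _ fun i _ => Submodule.smul_mem _ _ ?_
  have h1 : complexify n (EuclideanSpace.single i 1) ∈ complexNonexpandingSubspace B := hall _
  convert h1 using 1
  ext k
  simp [complexify, Pi.single_apply, apply_ite]

/-! ### Dilations and Lebesgue measure -/

theorem det_zpow (B : Matrix (Fin n) (Fin n) ℝ) (j : ℤ) : (B ^ j).det = B.det ^ j :=
  map_zpow' Matrix.detMonoidHom (fun M => by simp [Matrix.det_nonsing_inv]) B j

theorem measurable_powAct (B : Matrix (Fin n) (Fin n) ℝ) (j : ℤ) : Measurable (powAct B j) :=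
  (LinearMap.continuous_of_finiteDimensional (Matrix.toEuclideanLin (B ^ j))).measurable

theorem map_powAct_volume {B : Matrix (Fin n) (Fin n) ℝ} (hB : B.det ≠ 0) (j : ℤ) :
    (volume : Measure (Rn n)).map (powAct B j) = ENNReal.ofReal (|B.det| ^ (-j)) • volume := by
  have hdet : LinearMap.det (Matrix.toEuclideanLin (B ^ j)) = B.det ^ j := by
    rw [← det_zpow]
    exact LinearMap.det_toLpLin _ _
  have := Measure.map_linearMap_addHaar_eq_smul_addHaar (volume : Measure (Rn n))
    (f := Matrix.toEuclideanLin (B ^ j)) (by rw [hdet]; exact zpow_ne_zero _ hB)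
  rw [hdet, ← zpow_neg, abs_zpow] at this
  exact this

theorem quasiMeasurePreserving_powAct {B : Matrix (Fin n) (Fin n) ℝ} (hB : B.det ≠ 0) (j : ℤ) :
    Measure.QuasiMeasurePreserving (powAct B j) (volume : Measure (Rn n)) volume :=
  ⟨measurable_powAct B j, by
    rw [map_powAct_volume hB]
    exact Measure.smul_absolutelyContinuous⟩

theorem lintegral_comp_powAct {B : Matrix (Fin n) (Fin n) ℝ} (hB : B.det ≠ 0) (j : ℤ)
    {g : Rn n → ℝ≥0∞} (hg : Measurable g) :
    ∫⁻ ξ, g (powAct B j ξ) = ENNReal.ofReal (|B.det| ^ (-j)) * ∫⁻ ξ, g ξ := by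
  rw [← lintegral_map hg (measurable_powAct B j), map_powAct_volume hB, lintegral_smul_measure,
    smul_eq_mul]

/-- After the change of variables `η = B ^ (-j) ξ`, this sum is the integral of `g` against the
number of visits of the orbit of `η` to `K`. -/
theorem tsum_det_mul_setLIntegral_comp_powAct_le {B : Matrix (Fin n) (Fin n) ℝ} (hB : B.det ≠ 0)
    {K : Set (Rn n)} (hK : MeasurableSet K) {N : ℝ≥0∞}
    (hN : ∀ ξ : Rn n, ∑' j : ℤ, K.indicator (1 : Rn n → ℝ≥0∞) (powAct B j ξ) ≤ N)
    {g : Rn n → ℝ≥0∞} (hg : Measurable g) :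
    ∑' j : ℤ, ENNReal.ofReal (|B.det| ^ (-j)) * ∫⁻ ξ in K, g (powAct B (-j) ξ)
      ≤ N * ∫⁻ ξ, g ξ := by
  have h1 : Measurable (K.indicator (1 : Rn n → ℝ≥0∞)) := measurable_one.indicator hK
  have key : ∀ j : ℤ, ENNReal.ofReal (|B.det| ^ (-j)) * ∫⁻ ξ in K, g (powAct B (-j) ξ)
      = ∫⁻ ξ, K.indicator 1 (powAct B j ξ) * g ξ := by
    intro j
    have h2 : ∫⁻ ξ in K, g (powAct B (-j) ξ)
        = ∫⁻ ξ, K.indicator (1 : Rn n → ℝ≥0∞) ξ * g (powAct B (-j) ξ) := by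
      rw [← lintegral_indicator hK]
      refine lintegral_congr fun ξ => ?_
      by_cases h : ξ ∈ K <;> simp [h]
    rw [h2, ← lintegral_comp_powAct hB j
      (g := fun ξ => K.indicator (1 : Rn n → ℝ≥0∞) ξ * g (powAct B (-j) ξ))
      (h1.mul (hg.comp (measurable_powAct B (-j))))]
    simp_rw [powAct_neg_apply_powAct hB]
  simp_rw [key]
  have hm : ∀ j : ℤ, AEMeasurable fun ξ => K.indicator (1 : Rn n → ℝ≥0∞) (powAct B j ξ) * g ξ :=
    fun j => ((h1.comp (measurable_powAct B j)).mul hg).aemeasurable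
  rw [← lintegral_tsum hm,
    ← lintegral_const_mul _ hg]
  refine lintegral_mono fun ξ => ?_
  rw [ENNReal.tsum_mul_right]
  exact mul_le_mul_left (hN ξ) _

/-! ### Lattice points -/

/-- A point of the dual lattice is determined by its integer inner products with a basis of `ℝⁿ`
contained in the lattice. -/
theorem finite_dualLattice_inter {Γ : Submodule ℤ (Rn n)} [DiscreteTopology Γ] [IsZLattice ℝ Γ]
    {s : Set (Rn n)} (hs : Bornology.IsBounded s) :
    ((dualLattice Γ : Set (Rn n)) ∩ s).Finite := by
  obtain ⟨b, hbΓ, hbspan, hli⟩ := exists_linearIndependent ℝ (Γ : Set (Rn n))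
  rw [IsZLattice.span_top] at hbspan
  have : Finite b := hli.setFinite
  obtain ⟨R, hR⟩ := hs.exists_norm_le
  refine Set.Finite.of_finite_image (f := fun x (y : b) => inner ℝ x (y : Rn n)) ?_ ?_
  · refine (Set.Finite.pi fun y : b => (Set.finite_Icc (-⌈R * ‖(y : Rn n)‖⌉)
      ⌈R * ‖(y : Rn n)‖⌉).image ((↑) : ℤ → ℝ)).subset ?_
    rintro _ ⟨x, ⟨hxΛ, hxs⟩, rfl⟩ y -
    obtain ⟨m, hm⟩ := mem_dualLattice.1 hxΛ y (hbΓ y.2)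
    refine ⟨m, ?_, hm.symm⟩
    have h1 : |(m : ℝ)| ≤ ⌈R * ‖(y : Rn n)‖⌉ := by
      rw [← hm]
      refine (abs_real_inner_le_norm _ _).trans (le_trans ?_ (Int.le_ceil _))
      gcongr
      exact hR x hxs
    rw [← Int.cast_abs, Int.cast_le] at h1
    exact abs_le.1 h1
  · intro x _ x' _ hxx'
    have h2 : ∀ y : Rn n, inner ℝ (x - x') y = 0 := by
      intro y
      have hy : y ∈ Submodule.span ℝ b := hbspan ▸ Submodule.mem_top
      induction hy using Submodule.span_induction with
      | mem y hy =>
        rw [inner_sub_left, sub_eq_zero]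
        exact congrFun hxx' ⟨y, hy⟩
      | zero => simp
      | add u v _ _ hu hv => rw [inner_add_right, hu, hv, add_zero]
      | smul c u _ hu => rw [inner_smul_right, hu, mul_zero]
    exact sub_eq_zero.1 (inner_self_eq_zero.1 (h2 (x - x')))

theorem isBounded_powAct_image_ball (B : Matrix (Fin n) (Fin n) ℝ) (j : ℤ) (r : ℝ) :
    Bornology.IsBounded (powAct B j '' Metric.ball 0 r) :=
  (((isCompact_closedBall (0 : Rn n) r).image
    (LinearMap.continuous_of_finiteDimensional (Matrix.toEuclideanLin (B ^ j)))).isBounded).subset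
    (image_mono Metric.ball_subset_closedBall)

theorem mem_powAct_image_ball {B : Matrix (Fin n) (Fin n) ℝ} (hB : B.det ≠ 0) {j : ℤ} {r : ℝ}
    {x : Rn n} : x ∈ powAct B j '' Metric.ball 0 r ↔ ‖powAct B (-j) x‖ < r := by
  constructor
  · rintro ⟨y, hy, rfl⟩
    rwa [powAct_neg_apply_powAct hB, ← mem_ball_zero_iff]
  · exact fun h => ⟨_, mem_ball_zero_iff.2 h, powAct_apply_powAct_neg hB j x⟩

/-- The lattice points in `B^j(𝐁(0, r))`, as points of the lattice. -/
theorem exists_finset_mem_iff_norm_powAct_lt {B : Matrix (Fin n) (Fin n) ℝ} (hB : B.det ≠ 0)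
    (Γ : Submodule ℤ (Rn n)) [DiscreteTopology Γ] [IsZLattice ℝ Γ] (j : ℤ) (r : ℝ) :
    ∃ S : Finset (dualLattice Γ), (∀ k, k ∈ S ↔ ‖powAct B (-j) (k : Rn n)‖ < r) ∧
      S.card = ((dualLattice Γ : Set (Rn n)) ∩ powAct B j '' Metric.ball 0 r).ncard := by
  have hfin := finite_dualLattice_inter (Γ := Γ) (isBounded_powAct_image_ball B j r)
  have hpre := hfin.preimage (Subtype.val_injective (p := (· ∈ dualLattice Γ))).injOn
  refine ⟨hpre.toFinset, fun k => ?_, ?_⟩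
  · simp only [Set.Finite.mem_toFinset, mem_preimage, mem_inter_iff, mem_powAct_image_ball hB]
    exact and_iff_right k.2
  · rw [← Set.ncard_eq_toFinset_card _ hpre]
    exact Set.ncard_preimage_of_injective_subset_range Subtype.val_injective
      (by rw [Subtype.range_coe]; exact inter_subset_left)

/-! ### Functions with prescribed Fourier transform -/

theorem exists_mem_testClass_fourier_eq_indicator (E : Submodule ℝ (Rn n)) {K : Set (Rn n)}
    (hK : IsCompact K) (hKE : K ⊆ (E : Set (Rn n))ᶜ) :
    ∃ f ∈ testClass E, ((𝓕 f : L2 n) : Rn n → ℂ) =ᵐ[volume] K.indicator 1 := by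
  have hμ : volume K ≠ ∞ := hK.measure_lt_top.ne
  refine ⟨𝓕⁻ (indicatorConstLp 2 hK.measurableSet hμ (1 : ℂ)), ?_, ?_⟩
  · rw [testClass, mem_ofPred_eq, FourierTransform.fourier_fourierInv_eq]
    refine ⟨(memLp_congr_ae indicatorConstLp_coeFn).2
      (memLp_indicator_const _ hK.measurableSet _ (Or.inr hμ)), K, hK, hKE, ?_⟩
    filter_upwards [indicatorConstLp_coeFn (p := 2) (hs := hK.measurableSet) (hμs := hμ)
      (c := (1 : ℂ))] with ξ hξ hξK
    rw [hξ, indicator_of_notMem hξK]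
  · rw [FourierTransform.fourier_fourierInv_eq]
    exact indicatorConstLp_coeFn

theorem exists_enorm_fourier_sq_eq {g : Rn n → ℝ≥0∞} (hg : Measurable g)
    (hfin : ∫⁻ ξ, g ξ ≠ ∞) : ∃ ψ : L2 n, ∀ᵐ ξ, ‖(𝓕 ψ : L2 n) ξ‖ₑ ^ 2 = g ξ := by
  set h : Rn n → ℂ := fun ξ => ((Real.sqrt (g ξ).toReal : ℝ) : ℂ) with hh
  have hsq : ∀ᵐ ξ, ‖h ξ‖ₑ ^ 2 = g ξ := by
    filter_upwards [ae_lt_top hg hfin] with ξ hξ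
    have : ‖h ξ‖ₑ = ENNReal.ofReal (Real.sqrt (g ξ).toReal) := by
      rw [← ofReal_norm, hh, Complex.norm_real, Real.norm_of_nonneg (Real.sqrt_nonneg _)]
    rw [this, ← ENNReal.ofReal_pow (Real.sqrt_nonneg _), Real.sq_sqrt ENNReal.toReal_nonneg,
      ENNReal.ofReal_toReal hξ.ne]
  have hmem : MemLp h 2 volume := by
    refine ⟨(Complex.measurable_ofReal.comp
      hg.ennreal_toReal.sqrt).aestronglyMeasurable, ?_⟩
    rw [eLpNorm_lt_top_iff_lintegral_rpow_enorm_lt_top (by simp) (by simp)]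
    have : ∫⁻ ξ, ‖h ξ‖ₑ ^ (2 : ℝ≥0∞).toReal = ∫⁻ ξ, g ξ := by
      refine lintegral_congr_ae ?_
      filter_upwards [hsq] with ξ hξ
      simpa using hξ
    rw [this]
    exact hfin.lt_top
  refine ⟨𝓕⁻ hmem.toLp, ?_⟩
  rw [FourierTransform.fourier_fourierInv_eq]
  filter_upwards [hsq, hmem.coeFn_toLp] with ξ h1 h2
  rw [h2, h1]

/-! ### The Calderón condition and the local integrability condition -/

theorem measurable_enorm_fourier_sq (ψ : L2 n) :
    Measurable fun ξ => ‖(𝓕 ψ : L2 n) ξ‖ₑ ^ 2 :=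
  (Lp.stronglyMeasurable (𝓕 ψ : L2 n)).measurable.enorm.pow_const 2

theorem setLIntegral_calderonSum {L : ℕ} (ψ : Fin L → L2 n) (B : Matrix (Fin n) (Fin n) ℝ)
    (K : Set (Rn n)) : ∫⁻ ξ in K, calderonSum ψ B ξ
      = ∑ l : Fin L, ∑' j : ℤ, ∫⁻ ξ in K, ‖(𝓕 (ψ l) : L2 n) (powAct B (-j) ξ)‖ₑ ^ 2 := by
  have hm : ∀ (l : Fin L) (j : ℤ),
      Measurable fun ξ => ‖(𝓕 (ψ l) : L2 n) (powAct B (-j) ξ)‖ₑ ^ 2 := fun l j =>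
    (measurable_enorm_fourier_sq (ψ l)).comp (measurable_powAct B (-j))
  unfold calderonSum
  rw [lintegral_finsetSum _ fun l _ => Measurable.tsum (hm l)]
  exact Finset.sum_congr rfl fun l _ => lintegral_tsum fun j => (hm l j).aemeasurable

theorem setLIntegral_support_eq_of_ae_eq_indicator {F : Rn n → ℂ} {K : Set (Rn n)}
    (hF : F =ᵐ[volume] K.indicator 1) (c : Rn n) (h : Rn n → ℝ≥0∞) :
    ∫⁻ ξ in Function.support F, ‖F (ξ + c)‖ₑ ^ 2 * h ξ
      = ∫⁻ ξ in K, K.indicator 1 (ξ + c) * h ξ := by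
  have hsupp : Function.support F =ᵐ[volume] K := by
    filter_upwards [hF] with ξ hξ
    refine propext ?_
    change F ξ ≠ 0 ↔ ξ ∈ K
    by_cases hK : ξ ∈ K <;> simp [hξ, hK]
  rw [setLIntegral_congr hsupp]
  refine lintegral_congr_ae (ae_restrict_of_ae ?_)
  filter_upwards [(measurePreserving_add_right volume c).quasiMeasurePreserving.ae hF] with ξ hξ
  rw [hξ]
  by_cases hK : ξ + c ∈ K <;> simp [hK]

theorem setLIntegral_support_le_of_ae_vanish {F : Rn n → ℂ} {K : Set (Rn n)} {M : ℝ≥0∞}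
    (hM : M ≠ ∞) (hFM : ∀ᵐ ξ, ‖F ξ‖ₑ ≤ M) (hFK : ∀ᵐ ξ, ξ ∉ K → F ξ = 0) (c : Rn n)
    (h : Rn n → ℝ≥0∞) :
    ∫⁻ ξ in Function.support F, ‖F (ξ + c)‖ₑ ^ 2 * h ξ
      ≤ M ^ 2 * ∫⁻ ξ in K, K.indicator 1 (ξ + c) * h ξ := by
  have hsupp : Function.support F ≤ᵐ[volume] K := by
    filter_upwards [hFK] with ξ hξ hξF
    by_contra hξK
    exact hξF (hξ hξK)
  rw [← lintegral_const_mul' _ _ (ENNReal.pow_ne_top hM)]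
  refine (lintegral_mono_ae (ae_restrict_of_ae ?_)).trans (lintegral_mono'
    (Measure.restrict_mono_ae hsupp) le_rfl)
  have hadd := (measurePreserving_add_right (volume : Measure (Rn n)) c).quasiMeasurePreserving
  filter_upwards [hadd.ae hFM, hadd.ae hFK] with ξ h1 h2
  by_cases hK : ξ + c ∈ K
  · rw [indicator_of_mem hK, Pi.one_apply, one_mul]
    gcongr
  · simp [h2 hK]

/-- The local integrability condition contains the Calderón condition: it is the part `k = 0`
of the sum over the dual lattice, for `f` with `f̂ = 1_K`. -/
theorem CalderonIntegrability.of_localIntegrabilityCondition {L : ℕ} {E : Submodule ℝ (Rn n)}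
    {ψ : Fin L → L2 n} {A : Matrix (Fin n) (Fin n) ℝ} {Γ : Submodule ℤ (Rn n)}
    (h : LocalIntegrabilityCondition E ψ A Γ) : CalderonIntegrability E ψ A.transpose := by
  intro K hK hKE
  obtain ⟨f, hf, hfK⟩ := exists_mem_testClass_fourier_eq_indicator E hK hKE
  refine lt_of_le_of_lt ?_ (h f hf)
  rw [setLIntegral_calderonSum, licSum]
  refine Finset.sum_le_sum fun l _ => ENNReal.tsum_le_tsum fun j => ?_
  refine le_trans (le_of_eq ?_) (ENNReal.le_tsum 0)
  rw [setLIntegral_support_eq_of_ae_eq_indicator hfK]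
  refine setLIntegral_congr_fun hK.measurableSet fun ξ hξ => ?_
  simp [powAct, hξ]

/-- Under the lattice counting estimate, at most `C (1 + |det B| ^ (-j))` lattice translates
contribute at scale `j`. The part `C` is controlled by the Calderón condition, the part
`C |det B| ^ (-j)` by the bounded number of visits of orbits to the support of `f̂`. -/
theorem LatticeCountingEstimate.localIntegrabilityCondition {L : ℕ}
    {A : Matrix (Fin n) (Fin n) ℝ} (hA : A.det ≠ 0) {Γ : Submodule ℤ (Rn n)}
    [DiscreteTopology Γ] [IsZLattice ℝ Γ]
    (hLCE : LatticeCountingEstimate A.transpose (dualLattice Γ))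
    {ψ : Fin L → L2 n}
    (hC : CalderonIntegrability (nonexpandingSubspace A.transpose) ψ A.transpose) :
    LocalIntegrabilityCondition (nonexpandingSubspace A.transpose) ψ A Γ := by
  rintro f ⟨hfM, K, hK, hKE, hfK⟩
  set B := A.transpose with hBdef
  have hB : B.det ≠ 0 := by rwa [hBdef, Matrix.det_transpose]
  obtain ⟨N, hN⟩ := exists_tsum_indicator_powAct_le hB hK hKE
  obtain ⟨R, hR⟩ := hK.isBounded.exists_norm_le
  obtain ⟨C, hcount⟩ := hLCE (|R| + |R| + 1) (by positivity)
  set M := eLpNorm (𝓕 f : L2 n) ∞ volume with hMdef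
  have hM : M ≠ ∞ := hfM.2.ne
  have hFM : ∀ᵐ ξ, ‖(𝓕 f : L2 n) ξ‖ₑ ≤ M := by
    rw [hMdef, eLpNorm_exponent_top]
    exact enorm_ae_le_eLpNormEssSup _ _
  set c : ℝ≥0∞ := M ^ 2 * ENNReal.ofReal |C| with hc
  have hctop : c ≠ ∞ := ENNReal.mul_ne_top (ENNReal.pow_ne_top hM) ENNReal.ofReal_ne_top
  rw [licSum, ENNReal.sum_lt_top]
  intro l _
  set I : ℤ → ℝ≥0∞ := fun j => ∫⁻ ξ in K, ‖(𝓕 (ψ l) : L2 n) (powAct B (-j) ξ)‖ₑ ^ 2 with hI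
  have hterm : ∀ j : ℤ, (∑' k : dualLattice Γ, ∫⁻ ξ in Function.support (𝓕 f : L2 n),
      ‖(𝓕 f : L2 n) (ξ + powAct B j k)‖ₑ ^ 2 * ‖(𝓕 (ψ l) : L2 n) (powAct B (-j) ξ)‖ₑ ^ 2)
      ≤ c * (I j + ENNReal.ofReal (|B.det| ^ (-j)) * I j) := by
    intro j
    obtain ⟨S, hS, hScard⟩ := exists_finset_mem_iff_norm_powAct_lt hB Γ (-j) (|R| + |R| + 1)
    refine (ENNReal.tsum_le_tsum fun k : dualLattice Γ =>
      setLIntegral_support_le_of_ae_vanish hM hFM hfK (powAct B j k)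
        fun ξ => ‖(𝓕 (ψ l) : L2 n) (powAct B (-j) ξ)‖ₑ ^ 2).trans ?_
    rw [tsum_eq_sum (s := S)]
    · have h1 : ∀ k ∈ S, M ^ 2 * ∫⁻ ξ in K, K.indicator (1 : Rn n → ℝ≥0∞) (ξ + powAct B j k) *
          ‖(𝓕 (ψ l) : L2 n) (powAct B (-j) ξ)‖ₑ ^ 2 ≤ M ^ 2 * I j := by
        intro k _
        refine mul_le_mul_right (lintegral_mono fun ξ => ?_) _
        have h3 : K.indicator (1 : Rn n → ℝ≥0∞) (ξ + powAct B j k) ≤ 1 :=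
          indicator_apply_le' (fun _ => le_rfl) fun _ => zero_le_one
        exact mul_le_of_le_one_left zero_le h3
      refine (Finset.sum_le_card_nsmul _ _ _ h1).trans ?_
      have h2 : (S.card : ℝ≥0∞)
          ≤ ENNReal.ofReal |C| * (1 + ENNReal.ofReal (|B.det| ^ (-j))) := by
        have hd : 0 ≤ |B.det| ^ (-j) := zpow_nonneg (abs_nonneg _) _
        rw [← ENNReal.ofReal_one, ← ENNReal.ofReal_add zero_le_one hd,
          ← ENNReal.ofReal_mul (abs_nonneg C), ← ENNReal.ofReal_natCast, hScard]
        refine ENNReal.ofReal_le_ofReal ((hcount (-j)).2.trans ?_)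
        refine mul_le_mul (le_abs_self C) ?_ (by positivity) (abs_nonneg C)
        exact max_le (by linarith) (by linarith)
      calc S.card • (M ^ 2 * I j) = S.card * (M ^ 2 * I j) := nsmul_eq_mul _ _
        _ ≤ ENNReal.ofReal |C| * (1 + ENNReal.ofReal (|B.det| ^ (-j))) * (M ^ 2 * I j) := by gcongr
        _ = c * (I j + ENNReal.ofReal (|B.det| ^ (-j)) * I j) := by rw [hc]; ring
    · intro k hk
      rw [hS, neg_neg, not_lt] at hk
      have h0 : ∫⁻ ξ in K, K.indicator (1 : Rn n → ℝ≥0∞) (ξ + powAct B j k) *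
          ‖(𝓕 (ψ l) : L2 n) (powAct B (-j) ξ)‖ₑ ^ 2 = ∫⁻ _ in K, 0 := by
        refine setLIntegral_congr_fun hK.measurableSet fun ξ hξ => ?_
        have hnot : ξ + powAct B j k ∉ K := by
          intro hmem
          have h3 := norm_sub_le (ξ + powAct B j k) ξ
          rw [add_sub_cancel_left] at h3
          linarith [hR _ hmem, hR _ hξ, le_abs_self R]
        simp only [indicator_of_notMem hnot, zero_mul]
      rw [h0, lintegral_zero, mul_zero]
  refine (ENNReal.tsum_le_tsum hterm).trans_lt ?_
  rw [ENNReal.tsum_mul_left, ENNReal.tsum_add]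
  refine ENNReal.mul_lt_top hctop.lt_top (ENNReal.add_lt_top.2 ⟨?_, ?_⟩)
  · have h4 := hC K hK hKE
    rw [setLIntegral_calderonSum, ENNReal.sum_lt_top] at h4
    exact h4 l (Finset.mem_univ l)
  · refine (tsum_det_mul_setLIntegral_comp_powAct_le hB hK.measurableSet hN
      (measurable_enorm_fourier_sq (ψ l))).trans_lt ?_
    refine ENNReal.mul_lt_top (by simp) ?_
    have h5 := (Lp.memLp (𝓕 (ψ l) : L2 n)).2
    rw [eLpNorm_lt_top_iff_lintegral_rpow_enorm_lt_top (by simp) (by simp)] at h5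
    simpa using h5

/-! ### Failure of the lattice counting estimate -/

/-- There are balls of any radius off a proper subspace. -/
theorem exists_closedBall_subset_compl {E : Submodule ℝ (Rn n)} {x : Rn n} (hx : x ∉ E) (R : ℝ) :
    ∃ y : Rn n, Metric.closedBall y R ⊆ (E : Set (Rn n))ᶜ := by
  obtain ⟨δ, hδ, hball⟩ := Metric.isOpen_iff.1
    (Submodule.closed_of_finiteDimensional E).isOpen_compl x hx
  set t : ℝ := (|R| + 1) / δ with ht
  have ht0 : 0 < t := by positivity
  refine ⟨t • x, fun y hy hyE => ?_⟩
  refine hball (?_ : t⁻¹ • y ∈ Metric.ball x δ) (E.smul_mem _ hyE)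
  rw [Metric.mem_closedBall, dist_eq_norm] at hy
  have h1 : t⁻¹ • y - x = t⁻¹ • (y - t • x) := by
    rw [smul_sub, smul_smul, inv_mul_cancel₀ ht0.ne', one_smul]
  rw [Metric.mem_ball, dist_eq_norm, h1, norm_smul, norm_inv, Real.norm_of_nonneg ht0.le,
    inv_mul_lt_iff₀ ht0, ht, div_mul_cancel₀ _ hδ.ne']
  linarith [le_abs_self R]

/-- If the orbits of `B` visit `D` boundedly often, a superposition `|ψ̂|² = ∑ a_i 1_{B^{j_i} D}`
with `∑ a_i < ∞` has a bounded Calderón sum. -/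
theorem calderonIntegrability_of_fourier_sq_eq_tsum {B : Matrix (Fin n) (Fin n) ℝ}
    (hB : B.det ≠ 0) {D : Set (Rn n)} {N : ℝ≥0∞} (hN0 : N ≠ ∞)
    (hN : ∀ ξ : Rn n, ∑' j : ℤ, D.indicator (1 : Rn n → ℝ≥0∞) (powAct B j ξ) ≤ N)
    {a : ℕ → ℝ≥0∞} (ha : ∑' i, a i ≠ ∞) (J : ℕ → ℤ) {ψ : L2 n}
    (hψ : ∀ᵐ ξ, ‖(𝓕 ψ : L2 n) ξ‖ₑ ^ 2 = ∑' i, a i * D.indicator 1 (powAct B (-J i) ξ))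
    (E : Submodule ℝ (Rn n)) : CalderonIntegrability E (fun _ : Fin 1 => ψ) B := by
  intro K hK _
  have hbound : ∀ᵐ ξ, calderonSum (fun _ : Fin 1 => ψ) B ξ ≤ (∑' i, a i) * N := by
    filter_upwards [ae_all_iff.2 fun j : ℤ => (quasiMeasurePreserving_powAct hB (-j)).ae hψ]
      with ξ hξ
    simp only [calderonSum, Finset.univ_unique, Finset.sum_singleton, hξ]
    rw [ENNReal.tsum_comm, ← ENNReal.tsum_mul_right]
    refine ENNReal.tsum_le_tsum fun i => ?_
    rw [ENNReal.tsum_mul_left]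
    gcongr
    refine le_of_eq_of_le ?_ (hN ξ)
    rw [← (Equiv.subLeft (-J i)).tsum_eq]
    refine tsum_congr fun j => ?_
    rw [← powAct_add_apply hB, Equiv.subLeft_apply, show -J i + -(-J i - j) = j by ring]
  calc ∫⁻ ξ in K, calderonSum (fun _ : Fin 1 => ψ) B ξ
      ≤ ∫⁻ _ in K, (∑' i, a i) * N := lintegral_mono_ae (ae_restrict_of_ae hbound)
    _ = (∑' i, a i) * N * volume K := setLIntegral_const _ _
    _ < ∞ := ENNReal.mul_lt_top (ENNReal.mul_lt_top ha.lt_top hN0.lt_top) hK.measure_lt_top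

/-- If `|ψ̂|² ≥ a` on `B^j(𝐁(x, r))` and `f̂ = 1_K` with `K = 𝐁(x, 2r)`, then every lattice point
in `B^j(𝐁(0, r))` contributes at least `a |𝐁(x, r)|` to the term of scale `-j` of `L(f)`. -/
theorem ncard_mul_le_licSum {A : Matrix (Fin n) (Fin n) ℝ} (hA : A.det ≠ 0)
    (Γ : Submodule ℤ (Rn n)) [DiscreteTopology Γ] [IsZLattice ℝ Γ] {x : Rn n} {r : ℝ}
    (hr : 0 ≤ r) {f ψ : L2 n}
    (hf : ((𝓕 f : L2 n) : Rn n → ℂ) =ᵐ[volume] (Metric.closedBall x (2 * r)).indicator 1)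
    {a : ℝ≥0∞} {j : ℤ}
    (hψ : ∀ᵐ ξ, powAct A.transpose (-j) ξ ∈ Metric.closedBall x r → a ≤ ‖(𝓕 ψ : L2 n) ξ‖ₑ ^ 2) :
    (((dualLattice Γ : Set (Rn n)) ∩ powAct A.transpose j '' Metric.ball 0 r).ncard : ℝ≥0∞) *
      (a * volume (Metric.closedBall x r)) ≤ licSum (fun _ : Fin 1 => ψ) A Γ f := by
  set B := A.transpose with hBdef
  have hB : B.det ≠ 0 := by rwa [hBdef, Matrix.det_transpose]
  obtain ⟨S, hS, hScard⟩ := exists_finset_mem_iff_norm_powAct_lt hB Γ j r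
  rw [licSum, Finset.univ_unique, Finset.sum_singleton]
  refine le_trans ?_ (ENNReal.le_tsum (-j))
  refine le_trans ?_ (ENNReal.sum_le_tsum S)
  rw [← hScard, ← nsmul_eq_mul]
  refine Finset.card_nsmul_le_sum _ _ _ fun k hk => ?_
  rw [setLIntegral_support_eq_of_ae_eq_indicator hf, ← setLIntegral_const, neg_neg]
  refine le_trans (setLIntegral_mono_ae' measurableSet_closedBall ?_) (lintegral_mono_set
    (Metric.closedBall_subset_closedBall (by linarith : r ≤ 2 * r)))
  filter_upwards [(quasiMeasurePreserving_powAct hB j).ae hψ] with ξ hξ hξD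
  rw [powAct_neg_apply_powAct hB] at hξ
  have hmem : ξ + powAct B (-j) k ∈ Metric.closedBall x (2 * r) := by
    rw [Metric.mem_closedBall, dist_eq_norm] at hξD ⊢
    have h1 := norm_add_le (ξ - x) (powAct B (-j) (k : Rn n))
    rw [sub_add_eq_add_sub] at h1
    linarith [(hS k).1 hk]
  rw [indicator_of_mem hmem, Pi.one_apply, one_mul]
  exact hξ hξD

/-- If the lattice counting estimate fails at radius `r`, some `ψ` satisfies the Calderón
condition but not the local integrability condition: choose scales `j_i` with more than
`4^i max(1, |det B|^{j_i})` lattice points in `B^{j_i}(𝐁(0, r))`, and put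
`|ψ̂|² = ∑ 2^{-i} max(1, |det B|^{j_i})⁻¹ 1_{B^{j_i} D}` for a ball `D` of radius `r` far from `E`. -/
theorem exists_calderonIntegrability_not_localIntegrabilityCondition
    {A : Matrix (Fin n) (Fin n) ℝ} (hA : 1 < |A.det|) (Γ : Submodule ℤ (Rn n))
    [DiscreteTopology Γ] [IsZLattice ℝ Γ]
    (h : ¬ LatticeCountingEstimate A.transpose (dualLattice Γ)) :
    ∃ ψ : L2 n,
      CalderonIntegrability (nonexpandingSubspace A.transpose) (fun _ : Fin 1 => ψ) A.transpose ∧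
      ¬ LocalIntegrabilityCondition (nonexpandingSubspace A.transpose) (fun _ : Fin 1 => ψ) A Γ := by
  set B := A.transpose with hBdef
  have hdet : 1 < |B.det| := by rwa [hBdef, Matrix.det_transpose]
  have hB : B.det ≠ 0 := by
    intro h0
    simp only [h0, abs_zero] at hdet
    linarith
  have hA0 : A.det ≠ 0 := by rwa [← Matrix.det_transpose]
  obtain ⟨r, hr, hfail⟩ : ∃ r : ℝ, 0 < r ∧ ∀ C : ℝ, ∃ j : ℤ, C * max 1 (|B.det| ^ j)
      < ((dualLattice Γ : Set (Rn n)) ∩ powAct B j '' Metric.ball 0 r).ncard := by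
    by_contra! hcon
    refine h fun r hr => ?_
    obtain ⟨C, hC⟩ := hcon r hr
    exact ⟨C, fun j => ⟨finite_dualLattice_inter (isBounded_powAct_image_ball B j r), hC j⟩⟩
  choose J hJ using fun i : ℕ => hfail (4 ^ i)
  obtain ⟨x₀, hx₀⟩ := exists_notMem_nonexpandingSubspace hdet
  obtain ⟨x, hx⟩ := exists_closedBall_subset_compl hx₀ (2 * r)
  set D := Metric.closedBall x r with hD
  have hDK : D ⊆ Metric.closedBall x (2 * r) := Metric.closedBall_subset_closedBall (by linarith)
  have hDm : MeasurableSet D := measurableSet_closedBall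
  obtain ⟨N, hN⟩ := exists_tsum_indicator_powAct_le hB (isCompact_closedBall x r) (hDK.trans hx)
  set m : ℕ → ℝ := fun i => max 1 (|B.det| ^ J i) with hm
  have hm1 : ∀ i, 1 ≤ m i := fun i => le_max_left _ _
  have hm0 : ∀ i, 0 < m i := fun i => zero_lt_one.trans_le (hm1 i)
  set a : ℕ → ℝ≥0∞ := fun i => ENNReal.ofReal ((1 / 2) ^ i / m i) with ha
  have hgeom : ∑' i : ℕ, ENNReal.ofReal ((1 / 2) ^ i) ≠ ∞ := by
    rw [← ENNReal.ofReal_tsum_of_nonneg (fun i => by positivity) summable_geometric_two]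
    exact ENNReal.ofReal_ne_top
  have hasum : ∑' i, a i ≠ ∞ := by
    refine ne_top_of_le_ne_top hgeom (ENNReal.tsum_le_tsum fun i => ENNReal.ofReal_le_ofReal ?_)
    exact div_le_self (by positivity) (hm1 i)
  set g : Rn n → ℝ≥0∞ := fun ξ => ∑' i, a i * D.indicator 1 (powAct B (-J i) ξ) with hg
  have hD1 : Measurable (D.indicator (1 : Rn n → ℝ≥0∞)) := measurable_one.indicator hDm
  have hterm : ∀ i, Measurable fun ξ => a i * D.indicator (1 : Rn n → ℝ≥0∞) (powAct B (-J i) ξ) :=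
    fun i => (hD1.comp (measurable_powAct B _)).const_mul _
  have hgm : Measurable g := Measurable.tsum hterm
  have hgfin : ∫⁻ ξ, g ξ ≠ ∞ := by
    have h1 : ∫⁻ ξ, g ξ ≤ (∑' i : ℕ, ENNReal.ofReal ((1 / 2) ^ i)) * volume D := by
      rw [hg, lintegral_tsum fun i => (hterm i).aemeasurable, ← ENNReal.tsum_mul_right]
      refine ENNReal.tsum_le_tsum fun i => ?_
      have hDi : Measurable fun ξ => D.indicator (1 : Rn n → ℝ≥0∞) (powAct B (-J i) ξ) :=
        hD1.comp (measurable_powAct B _)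
      rw [lintegral_const_mul _ hDi, lintegral_comp_powAct hB _ hD1,
        lintegral_indicator_one hDm, neg_neg, ← mul_assoc, ha,
        ← ENNReal.ofReal_mul (div_nonneg (by positivity) (hm0 i).le)]
      gcongr
      rw [div_mul_eq_mul_div, div_le_iff₀ (hm0 i)]
      gcongr
      exact le_max_right _ _
    exact ne_top_of_le_ne_top (ENNReal.mul_ne_top hgeom measure_closedBall_lt_top.ne) h1
  obtain ⟨ψ, hψ⟩ := exists_enorm_fourier_sq_eq hgm hgfin
  refine ⟨ψ, calderonIntegrability_of_fourier_sq_eq_tsum hB (ENNReal.natCast_ne_top N) hN hasum J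
    hψ _, fun hLIC => ?_⟩
  obtain ⟨f, hf, hfK⟩ :=
    exists_mem_testClass_fourier_eq_indicator _ (isCompact_closedBall x (2 * r)) hx
  obtain ⟨i, hi⟩ := ENNReal.exists_nat_mul_gt
    (Metric.measure_closedBall_pos volume x hr).ne' (hLIC f hf).ne
  refine absurd hi (not_lt.2 (le_trans ?_ (ncard_mul_le_licSum hA0 Γ hr.le hfK (a := a i)
    (j := J i) ?_)))
  · rw [← mul_assoc]
    gcongr
    rw [← ENNReal.ofReal_natCast, ← ENNReal.ofReal_natCast, ha,
      ← ENNReal.ofReal_mul (Nat.cast_nonneg _)]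
    refine ENNReal.ofReal_le_ofReal ?_
    have h2 : (i : ℝ) ≤ 2 ^ i := by exact_mod_cast Nat.lt_two_pow_self.le
    have h3 : (4 ^ i * m i) * ((1 / 2) ^ i / m i) = (2 : ℝ) ^ i := by
      rw [mul_assoc, mul_div_cancel₀ _ (hm0 i).ne', ← mul_pow]
      norm_num
    rw [← h3] at h2
    refine h2.trans (mul_le_mul_of_nonneg_right (hJ i).le ?_)
    exact div_nonneg (by positivity) (hm0 i).le
  · filter_upwards [hψ] with ξ hξ hξD
    rw [hξ]
    refine le_trans ?_ (ENNReal.le_tsum i)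
    rw [indicator_of_mem hξD, Pi.one_apply, mul_one]

end WaveletLIC

theorem theorem3p8 (n : ℕ) (A : Matrix (Fin n) (Fin n) ℝ) (hA : 1 < |A.det|)
    (Γ : Submodule ℤ (EuclideanSpace ℝ (Fin n))) [DiscreteTopology Γ] [IsZLattice ℝ Γ] :
    WaveletLIC.LatticeCountingEstimate A.transpose (WaveletLIC.dualLattice Γ) ↔
      ∀ (L : ℕ) (ψ : Fin L → Lp ℂ 2 (volume : Measure (EuclideanSpace ℝ (Fin n)))),
        WaveletLIC.LocalIntegrabilityCondition
            (WaveletLIC.nonexpandingSubspace A.transpose) ψ A Γ ↔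
          WaveletLIC.CalderonIntegrability
            (WaveletLIC.nonexpandingSubspace A.transpose) ψ A.transpose := by
  have hA0 : A.det ≠ 0 := by
    intro h0
    simp only [h0, abs_zero] at hA
    linarith
  refine ⟨fun h L ψ => ⟨WaveletLIC.CalderonIntegrability.of_localIntegrabilityCondition,
    h.localIntegrabilityCondition hA0⟩, fun h => ?_⟩
  by_contra hLCE
  obtain ⟨ψ, hC, hL⟩ :=
    WaveletLIC.exists_calderonIntegrability_not_localIntegrabilityCondition hA Γ hLCE
  exact hL ((h 1 fun _ => ψ).2 hC)
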